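/- For $N\ge 1$ let $G=(V,E)$ be the $N\times N$ grid graph. An instance of size $N$ of the 2D Hidden Linear Function problem consists of bits $A=(A_e)_{e\in E}\in\{0,1\}^{E}$ and $b=(b_v)_{v\in V}\in\{0,1\}^{V}$, which define $$q:\{0,1\}^V\to\mathbb{Z}_4,\qquad q(x)=2\sum_{e=\{v,w\}\in E}A_e x_v x_w+\sum_{v\in V}b_v x_v .$$ Let $\mathcal{L}_q=\{x : q(x\oplus y)=q(x)+q(y)\ \text{for all } y\in\{0,1\}^V\}$, where $\oplus$ is entrywise addition modulo $2$. A solution of the instance is a string $z\in\{0,1\}^V$ with $q(x)=2\sum_{v\in V}z_v x_v$ in $\mathbb{Z}_4$ for all $x\in\mathcal{L}_q$. A classical circuit is a finite directed acyclic graph whose in-degree-zero vertices are input bits, in which every gate computes an arbitrary Boolean function of its incoming bits, and in which each output bit is the bit of a gate or of an input; the fan-in of a gate is its in-degree, fan-out is unbounded, and wires are not geometrically restricted. The depth is the maximum number of gates along a path from an input to an output. A classical probabilistic circuit for instances of size $N$ takes as input $A$, $b$ and a random string $r\in\{0,1\}^\ell$ (for some $\ell\ge 0$) drawn from an arbitrary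 probability distribution $\rho$ that does not depend on $(A,b)$, and outputs $z\in\{0,1\}^V$. **Theorem.** There is a universal constant $N_0$ such that the following holds for all $N\ge N_0$ and all $K$. Let $\mathcal{C}_N$ be a classical probabilistic circuit with fan-in at most $K$ such that, for every instance $(A,b)$ of size $N$, its output is a solution of that instance with probability greater than $7/8$. Then $K\ge 2$ and the depth of $\mathcal{C}_N$ is at least $$\frac18\,\frac{\log N}{\log K}.$$ -/

import Mathlib

open scoped ENNReal

/-! ### Classical Boolean circuits -/

/-- A classical circuit with input variables `I` and output variables `O`: a finite directed acyclic
graph. Its vertices of in-degree zero are the inputs `I`; every gate `g` has `fanIn g ≥ 1` incoming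
wires, each coming from an input or from another gate, and computes an arbitrary Boolean function of
the bits they carry. Every output is attached to an input or to a gate.
There is no restriction on how often the bit of an input or gate is used (unbounded fan-out), and no
geometric restriction on the wires. -/
structure BoolCircuit (I O : Type) where
  /-- the gates -/
  Gate : Type
  /-- there are finitely many gates -/
  finite_gate : Finite Gate
  /-- the in-degree of a gate -/
  fanIn : Gate → ℕ
  /-- vertices of in-degree zero are inputs, not gates -/
  fanIn_pos : ∀ g, 0 < fanIn g
  /-- the vertex from which the `k`-th incoming wire of a gate starts -/
  wire : (g : Gate) → Fin (fanIn g) → I ⊕ Gate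
  /-- the Boolean function computed by a gate -/
  fn : (g : Gate) → (Fin (fanIn g) → Bool) → Bool
  /-- the vertex to which an output is attached -/
  output : O → I ⊕ Gate
  /-- the graph has no directed cycle -/
  acyclic : ∀ g, ¬ Relation.TransGen (fun g₁ g₂ => ∃ k, wire g₂ k = Sum.inr g₁) g g

namespace BoolCircuit

variable {I O : Type} (C : BoolCircuit I O)

/-- There is a wire from the gate `g₁` to the gate `g₂`. -/
def Feeds (g₁ g₂ : C.Gate) : Prop := ∃ k, C.wire g₂ k = Sum.inr g₁

theorem wellFounded_feeds : WellFounded C.Feeds := by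
  have := C.finite_gate
  have : Std.Irrefl (Relation.TransGen C.Feeds) := ⟨C.acyclic⟩
  have h : WellFounded (Relation.TransGen C.Feeds) :=
    Finite.wellFounded_of_trans_of_irrefl _
  exact Subrelation.wf (fun h' => Relation.TransGen.single h') h

/-- The bit computed by the gate `g` when the inputs carry the bits `x`. -/
def gateValue (x : I → Bool) (g : C.Gate) : Bool :=
  C.fn g fun k =>
    match h : C.wire g k with
    | Sum.inl i => x i
    | Sum.inr g' => gateValue x g'
termination_by C.wellFounded_feeds.wrap g
decreasing_by exact ⟨k, h⟩

/-- The bit carried by a vertex (input or gate) when the inputs carry the bits `x`. -/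
def value (x : I → Bool) : I ⊕ C.Gate → Bool := Sum.elim x (C.gateValue x)

theorem gateValue_eq (x : I → Bool) (g : C.Gate) :
    C.gateValue x g = C.fn g fun k => C.value x (C.wire g k) := by
  rw [gateValue]
  congr 1
  funext k
  split <;> rename_i h <;> simp [value, h]

/-- The function `{0,1}^I → {0,1}^O` computed by the circuit. -/
def eval (x : I → Bool) : O → Bool := fun o => C.value x (C.output o)

/-- The maximum number of gates along a path from an input to the gate `g` (inclusive). -/
def gateDepth (g : C.Gate) : ℕ :=
  1 + Finset.univ.sup fun k : Fin (C.fanIn g) =>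
    match h : C.wire g k with
    | Sum.inl _ => 0
    | Sum.inr g' => gateDepth g'
termination_by C.wellFounded_feeds.wrap g
decreasing_by exact ⟨k, h⟩

/-- The maximum number of gates along a path from an input to the given vertex (inclusive). -/
def vertexDepth : I ⊕ C.Gate → ℕ := Sum.elim (fun _ => 0) C.gateDepth

theorem gateDepth_eq (g : C.Gate) :
    C.gateDepth g = 1 + Finset.univ.sup fun k => C.vertexDepth (C.wire g k) := by
  rw [gateDepth]
  congr 2
  funext k
  split <;> rename_i h <;> simp [vertexDepth, h]

/-- The depth: the maximum number of gates along a path from an input to an output. -/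
def depth [Fintype O] : ℕ := Finset.univ.sup fun o => C.vertexDepth (C.output o)

/-- All gates have fan-in at most `K`. -/
def FanInAtMost (K : ℕ) : Prop := ∀ g, C.fanIn g ≤ K

end BoolCircuit

/-! ### The 2D Hidden Linear Function problem -/

namespace HLF2D

/-- The vertices of the `N × N` grid. -/
abbrev Vertex (N : ℕ) : Type := Fin N × Fin N

/-- The `N × N` grid graph. -/
abbrev grid (N : ℕ) : SimpleGraph (Vertex N) :=
  SimpleGraph.boxProd (SimpleGraph.pathGraph N) (SimpleGraph.pathGraph N)

/-- The edges of the `N × N` grid. -/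
abbrev Edge (N : ℕ) : Type := (grid N).edgeSet

/-- A bit as an element of `ℤ/4`. -/
def bit (a : Bool) : ZMod 4 := if a then 1 else 0

/-- The monomial `x_v x_w` attached to the unordered pair `{v, w}`. -/
def edgeMonomial {N : ℕ} (x : Vertex N → Bool) (e : Sym2 (Vertex N)) : ZMod 4 :=
  Sym2.lift ⟨fun v w => bit (x v) * bit (x w), fun _ _ => mul_comm _ _⟩ e

open Classical in
/-- The quadratic form `q(x) = 2 ∑_{e = {v,w} ∈ E} A_e x_v x_w + ∑_{v ∈ V} b_v x_v`, with values
in `ℤ/4`. -/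
noncomputable def quadForm {N : ℕ} (A : Edge N → Bool) (b x : Vertex N → Bool) : ZMod 4 :=
  2 * ∑ e : Edge N, bit (A e) * edgeMonomial x e + ∑ v : Vertex N, bit (b v) * bit (x v)

/-- The set `L_q` of all `x` such that `q(x ⊕ y) = q(x) + q(y)` (in `ℤ/4`) for all `y`. -/
def linearSet {N : ℕ} (A : Edge N → Bool) (b : Vertex N → Bool) : Set (Vertex N → Bool) :=
  {x | ∀ y : Vertex N → Bool,
    quadForm A b (fun v => xor (x v) (y v)) = quadForm A b x + quadForm A b y}

/-- `z` solves the instance `(A, b)`: `q(x) = 2 zᵀx` (in `ℤ/4`) for all `x ∈ L_q`. -/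
def IsSolution {N : ℕ} (A : Edge N → Bool) (b z : Vertex N → Bool) : Prop :=
  ∀ x ∈ linearSet A b, quadForm A b x = 2 * ∑ v : Vertex N, bit (z v) * bit (x v)

/-- The input variables of a probabilistic circuit for instances of size `N`: the instance bits
`A_e` and `b_v`, and `l` random bits. -/
abbrev InputVar (N l : ℕ) : Type := (Edge N ⊕ Vertex N) ⊕ Fin l

/-- The assignment of the bits `A`, `b`, `r` to the input variables. -/
def inputBits {N l : ℕ} (A : Edge N → Bool) (b : Vertex N → Bool) (r : Fin l → Bool) :
    InputVar N l → Bool :=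
  Sum.elim (Sum.elim A b) r

/-- The probability, over the random string `r` drawn from `ρ`, that the output of the circuit is
a solution of the instance `(A, b)`. -/
noncomputable def successProb {N l : ℕ} (C : BoolCircuit (InputVar N l) (Vertex N))
    (ρ : PMF (Fin l → Bool)) (A : Edge N → Bool) (b : Vertex N → Bool) : ℝ≥0∞ :=
  ρ.toMeasure {r | IsSolution A b (C.eval (inputBits A b r))}

end HLF2D

/-! The proof is a locality argument. In a circuit of fan-in at most `K` and depth `d`, every output
bit depends on at most `s = K ^ d` inputs. Let `A` select a subdivided coarse grid and let `b` carry
three bits `t` at coarse vertices `u i` and vanish elsewhere. For `t` of even weight, `armVector`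
lies in the linear set and `q` takes the value `∑ t i` there (`armVector_mem_linearSet`,
`quadForm_armVector`). Over the four even strings these values add up to `0 + 2 + 2 + 2 = 2` in
`ZMod 4`.

Suppose that no output depends on two of the three bits, and that no output on the arm of `u j`
depends on another bit. Then at each grid vertex the products of solution bit and arm vector bit
have even sum over the four strings, so the same total is `0`: a contradiction
(`not_isSolution_of_local`). If `s` is small compared to `N`, counting bad pairs yields such `u i`
(`exists_triple`). Randomness is removed by a union bound: one random string would serve all four
instances. -/

/-! ### Light cones of circuits of bounded fan-in. -/

/-- The value of a vertex of a circuit of fan-in at most `K` depends on at most `K ^ d` inputs,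
where `d` is the depth of the vertex. -/
theorem BoolCircuit.exists_value_dependsOn {I O : Type} (C : BoolCircuit I O) {K : ℕ}
    (hK : C.FanInAtMost K) (hpos : 1 ≤ K) (v : I ⊕ C.Gate) :
    ∃ S : Finset I, S.card ≤ K ^ C.vertexDepth v ∧
      ∀ x y : I → Bool, (∀ i ∈ S, x i = y i) → C.value x v = C.value y v := by
  classical
  rcases v with i | g
  · exact ⟨{i}, by simp [vertexDepth], fun x y h => by simpa [value] using h⟩
  induction g using C.wellFounded_feeds.induction with
  | _ g ih =>
  have key : ∀ k : Fin (C.fanIn g), ∃ S : Finset I,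
      S.card ≤ K ^ C.vertexDepth (C.wire g k) ∧ ∀ x y : I → Bool, (∀ i ∈ S, x i = y i) →
        C.value x (C.wire g k) = C.value y (C.wire g k) := by
    intro k
    rcases h : C.wire g k with i | g'
    · exact ⟨{i}, by simp [vertexDepth], fun x y h => by simpa [value] using h⟩
    · exact ih g' ⟨k, h⟩
  choose S hS hv using key
  refine ⟨Finset.univ.biUnion S, ?_, fun x y hxy => ?_⟩
  · have hd : C.vertexDepth (Sum.inr g) =
        1 + Finset.univ.sup fun k => C.vertexDepth (C.wire g k) := C.gateDepth_eq g
    rw [hd, pow_add, pow_one]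
    calc (Finset.univ.biUnion S).card ≤ ∑ k, (S k).card := Finset.card_biUnion_le
      _ ≤ ∑ _k : Fin (C.fanIn g), K ^ Finset.univ.sup fun k => C.vertexDepth (C.wire g k) :=
        Finset.sum_le_sum fun k _ => (hS k).trans <| Nat.pow_le_pow_right hpos <|
          Finset.le_sup (f := fun k => C.vertexDepth (C.wire g k)) (Finset.mem_univ k)
      _ ≤ _ := by
        simp only [Finset.sum_const, Finset.card_univ, Fintype.card_fin, smul_eq_mul]
        exact Nat.mul_le_mul_right _ (hK g)
  · change C.gateValue x g = C.gateValue y g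
    rw [C.gateValue_eq, C.gateValue_eq]
    congr 1
    funext k
    exact hv k x y fun i hi => hxy i (Finset.mem_biUnion.2 ⟨k, Finset.mem_univ k, hi⟩)

/-- Every output bit of a circuit of fan-in at most `K` depends on at most `K ^ depth` inputs. -/
theorem BoolCircuit.exists_eval_dependsOn {I O : Type} [Fintype O] (C : BoolCircuit I O) {K : ℕ}
    (hK : C.FanInAtMost K) (hpos : 1 ≤ K) (o : O) :
    ∃ S : Finset I, S.card ≤ K ^ C.depth ∧
      ∀ x y : I → Bool, (∀ i ∈ S, x i = y i) → C.eval x o = C.eval y o := by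
  obtain ⟨S, hS, h⟩ := C.exists_value_dependsOn hK hpos (C.output o)
  exact ⟨S, hS.trans <| Nat.pow_le_pow_right hpos <|
    Finset.le_sup (f := fun o => C.vertexDepth (C.output o)) (Finset.mem_univ o), h⟩

/-! ### Two union bounds. -/

/-- If few ordered pairs are related by `R`, then there are three elements no two of which are
related, in either order. -/
theorem exists_triple_of_card_lt {α : Type*} [Fintype α] (R : α → α → Prop)
    [DecidableRel R]
    (h : 6 * (Finset.univ.filter fun p : α × α => R p.1 p.2).card < Fintype.card α ^ 2) :
    ∃ u : Fin 3 → α, ∀ i j, i ≠ j → ¬ R (u i) (u j) := by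
  classical
  have h0 : 0 < Fintype.card α := by
    by_contra h'
    simp [show Fintype.card α = 0 by omega] at h
  by_contra! hcon
  set c := (Finset.univ.filter fun p : α × α => R p.1 p.2).card with hc
  let bad : Fin 3 → Fin 3 → Finset (Fin 3 → α) := fun i j =>
    Finset.univ.filter fun u => R (u i) (u j)
  -- Each of the six ordered pairs of positions spoils at most `c` choices there, times a free
  -- choice at the third position `k`.
  have hbad : ∀ i j, i ≠ j → (bad i j).card ≤ c * Fintype.card α := by
    intro i j hij
    obtain ⟨k, hk⟩ : ∃ k : Fin 3, ∀ l, l = i ∨ l = j ∨ l = k := by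
      revert i j; decide
    rw [hc, ← Finset.card_univ, ← Finset.card_product]
    refine Finset.card_le_card_of_injOn (fun u => ((u i, u j), u k)) ?_ ?_
    · intro u hu
      simpa [bad] using hu
    · intro u _ v _ huv
      simp only [Prod.mk.injEq] at huv
      funext l
      rcases hk l with rfl | rfl | rfl
      exacts [huv.1.1, huv.1.2, huv.2]
  have hcover : (Finset.univ : Finset (Fin 3 → α)) ⊆
      (Finset.univ.filter fun p : Fin 3 × Fin 3 => p.1 ≠ p.2).biUnion
        fun p => bad p.1 p.2 := by
    intro u _
    obtain ⟨i, j, hij, hR⟩ := hcon u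
    exact Finset.mem_biUnion.2 ⟨(i, j), by simpa using hij, by simpa [bad] using hR⟩
  have h1 := Finset.card_le_card hcover
  have h2 := h1.trans (Finset.card_biUnion_le_card_mul _ _ (c * Fintype.card α) fun p hp =>
    hbad p.1 p.2 (by simpa using hp))
  have h3 : (Finset.univ.filter fun p : Fin 3 × Fin 3 => p.1 ≠ p.2).card = 6 := by decide
  rw [h3, Finset.card_univ, Fintype.card_fun, Fintype.card_fin] at h2
  nlinarith [Nat.mul_lt_mul_of_pos_right h h0]

/-- At most eight events of probability greater than `7 / 8` have a common point. -/
theorem MeasureTheory.exists_forall_mem_of_lt {Ω ι : Type*} [Fintype ι] [MeasurableSpace Ω]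
    (μ : Measure Ω) [IsProbabilityMeasure μ] (hι : Fintype.card ι ≤ 8) (s : ι → Set Ω)
    (hm : ∀ i, MeasurableSet (s i)) (h : ∀ i, 7 / 8 < μ (s i)) : ∃ ω, ∀ i, ω ∈ s i := by
  by_contra! hcon
  have hcover : (Set.univ : Set Ω) ⊆ ⋃ i ∈ (Finset.univ : Finset ι), (s i)ᶜ := by
    intro ω _
    obtain ⟨i, hi⟩ := hcon ω
    simpa using ⟨i, hi⟩
  have h1 : (1 : ℝ≥0∞) ≤ ∑ i, μ (s i)ᶜ := by
    rw [← measure_univ (μ := μ)]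
    exact (measure_mono hcover).trans (measure_biUnion_finset_le _ _)
  have hne : (Finset.univ : Finset ι).Nonempty := by
    rw [Finset.nonempty_iff_ne_empty]
    intro he
    simp [he] at h1
  have h2 : ∀ i ∈ (Finset.univ : Finset ι), μ (s i)ᶜ < 1 / 8 := by
    intro i _
    rw [prob_compl_eq_one_sub (hm i)]
    have h3 : (1 / 8 : ℝ≥0∞) + 7 / 8 = 1 := by
      rw [ENNReal.div_add_div_same]
      norm_num
      exact ENNReal.div_self (by norm_num) (by norm_num)
    have h4 : (1 / 8 : ℝ≥0∞) ≠ ∞ := by simp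
    rw [ENNReal.sub_lt_iff_lt_right (measure_ne_top _ _) prob_le_one]
    exact h3.symm.trans_lt <| (ENNReal.add_lt_add_iff_left h4).2 (h i)
  have h3 := ENNReal.sum_lt_sum_of_nonempty hne h2
  rw [Finset.sum_const, Finset.card_univ, nsmul_eq_mul] at h3
  have h4 : (Fintype.card ι : ℝ≥0∞) * (1 / 8) ≤ 1 := by
    rw [mul_one_div]
    exact ENNReal.div_le_of_le_mul (by rw [one_mul]; exact_mod_cast hι)
  exact absurd (h1.trans_lt (h3.trans_le h4)) (lt_irrefl _)

namespace HLF2D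

/-! ### The subdivided grid

For `2 * m + 1 ≤ N`, the `N × N` grid contains a subdivision of the `(m + 1) × (m + 1)` grid. The
vertices of the coarse grid are the vertices with two even coordinates; an edge of the coarse grid
corresponds to a vertex with one even and one odd coordinate, together with two grid edges. -/

/-- The horizontal and the vertical edges of the `(m + 1) × (m + 1)` grid. -/
abbrev CoarseEdge (m : ℕ) : Type := (Fin m × Fin (m + 1)) ⊕ (Fin (m + 1) × Fin m)

variable {m N : ℕ} (hN : 2 * m + 1 ≤ N)

/-- The vertex of the fine grid at an even-even position. -/
def corner (u : Fin (m + 1) × Fin (m + 1)) : Vertex N :=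
  (⟨2 * u.1, by omega⟩, ⟨2 * u.2, by omega⟩)

/-- The vertex subdividing a coarse edge. -/
def midpoint : CoarseEdge m → Vertex N
  | .inl (i, j) => (⟨2 * i + 1, by omega⟩, ⟨2 * j, by omega⟩)
  | .inr (i, j) => (⟨2 * i, by omega⟩, ⟨2 * j + 1, by omega⟩)

/-- The endpoint of a coarse edge that is closer to the origin. -/
def source : CoarseEdge m → Fin (m + 1) × Fin (m + 1)
  | .inl (i, j) => (i.castSucc, j)
  | .inr (i, j) => (i, j.castSucc)

/-- The endpoint of a coarse edge that is farther from the origin. -/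
def target : CoarseEdge m → Fin (m + 1) × Fin (m + 1)
  | .inl (i, j) => (i.succ, j)
  | .inr (i, j) => (i, j.succ)

theorem corner_injective : Function.Injective (corner hN) := by
  rintro ⟨i, j⟩ ⟨i', j'⟩ h
  simp only [corner, Prod.mk.injEq, Fin.ext_iff] at h ⊢
  omega

theorem adj_midpoint_source (e : CoarseEdge m) :
    (grid N).Adj (midpoint hN e) (corner hN (source e)) := by
  rcases e with ⟨i, j⟩ | ⟨i, j⟩ <;>
    simp [midpoint, source, corner, SimpleGraph.boxProd_adj, SimpleGraph.pathGraph_adj]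

theorem adj_midpoint_target (e : CoarseEdge m) :
    (grid N).Adj (midpoint hN e) (corner hN (target e)) := by
  rcases e with ⟨i, j⟩ | ⟨i, j⟩ <;>
    simp [midpoint, target, corner, SimpleGraph.boxProd_adj, SimpleGraph.pathGraph_adj] <;> omega

/-- The edges of the subdivided coarse grid. -/
def halfEdge : CoarseEdge m ⊕ CoarseEdge m → Edge N
  | .inl e => ⟨s(midpoint hN e, corner hN (source e)), adj_midpoint_source hN e⟩
  | .inr e => ⟨s(midpoint hN e, corner hN (target e)), adj_midpoint_target hN e⟩

theorem halfEdge_injective : Function.Injective (halfEdge hN) := by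
  rintro ((⟨i, j⟩ | ⟨i, j⟩) | (⟨i, j⟩ | ⟨i, j⟩)) ((⟨i', j'⟩ | ⟨i', j'⟩) | (⟨i', j'⟩ | ⟨i', j'⟩)) h <;>
    simp only [halfEdge, midpoint, source, target, corner, Subtype.mk.injEq, Sym2.eq_iff,
      Prod.mk.injEq, Fin.ext_iff, Fin.val_castSucc, Fin.val_succ, Sum.inl.injEq, Sum.inr.injEq,
      reduceCtorEq] at h ⊢ <;> omega

open Classical in
/-- The instance bits selecting the edges of the subdivided coarse grid. -/
noncomputable def gridBits (e : Edge N) : Bool := decide (e ∈ Set.range (halfEdge hN))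

/-- Every selected edge has exactly one midpoint as an end, so grouping by midpoints turns the edge
terms into a pairing of a set of coarse edges with its boundary. -/
theorem quadForm_gridBits (b x : Vertex N → Bool) :
    quadForm (gridBits hN) b x =
      ∑ e : CoarseEdge m, 2 * bit (x (midpoint hN e)) *
        (bit (x (corner hN (source e))) + bit (x (corner hN (target e)))) +
      ∑ v, bit (b v) * bit (x v) := by
  classical
  rw [quadForm]
  congr 1
  rw [← Fintype.sum_of_injective (halfEdge hN) (halfEdge_injective hN)
    (fun i => edgeMonomial x (halfEdge hN i).1) _ ?_ ?_, Fintype.sum_sum_type,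
    ← Finset.sum_add_distrib, Finset.mul_sum]
  · refine Finset.sum_congr rfl fun e _ => ?_
    simp only [halfEdge, edgeMonomial, Sym2.lift_mk]
    ring
  · intro e he
    simp [gridBits, he, bit]
  · intro i
    simp [gridBits, bit]

/-! ### Arms and their boundaries modulo 2. -/

/-- The odd vertices on the path from a vertex `p` with even coordinates along its column to row
`0`, and then along row `0` to the origin. -/
def OnArm (p v : Vertex N) : Prop :=
  (v.2.1 = 0 ∧ v.1.1 < p.1.1) ∨ (v.1.1 = p.1.1 ∧ v.2.1 < p.2.1)

instance (p v : Vertex N) : Decidable (OnArm p v) := by unfold OnArm; infer_instance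

theorem two_mul_bit_xor (a b : Bool) : 2 * bit (xor a b) = 2 * bit a + 2 * bit b := by
  revert a b; decide

/-- Interior terms occur twice with coefficient `2`, hence vanish modulo `4`. -/
theorem sum_telescope (F : ℕ → ZMod 4) (h : ∀ k, 4 * F k = 0) (n a : ℕ) (ha : a ≤ n) :
    ∑ k ∈ Finset.range n, (if k < a then 2 * (F k + F (k + 1)) else 0) = 2 * F 0 + 2 * F a := by
  induction n generalizing a with
  | zero =>
    obtain rfl : a = 0 := by omega
    simp only [Finset.range_zero, Finset.sum_empty]
    linear_combination -h 0
  | succ n ih =>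
    rw [Finset.sum_range_succ]
    rcases Nat.lt_or_ge n a with hlt | hge
    · obtain rfl : a = n + 1 := by omega
      have : ∀ k ∈ Finset.range n, (if k < n + 1 then 2 * (F k + F (k + 1)) else 0) =
          if k < n then 2 * (F k + F (k + 1)) else 0 := by
        intro k hk
        rw [Finset.mem_range] at hk
        rw [if_pos hk, if_pos (by omega)]
      rw [Finset.sum_congr rfl this, ih n le_rfl, if_pos hlt]
      linear_combination h n
    · rw [ih a hge, if_neg (by omega), add_zero]

/-- The boundary of an arm consists, modulo `2`, of its tip and the origin. -/
theorem sum_onArm (Y : Fin (m + 1) × Fin (m + 1) → ZMod 4) (u : Fin (m + 1) × Fin (m + 1)) :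
    ∑ e : CoarseEdge m, (if OnArm (corner hN u) (midpoint hN e) then
      2 * (Y (source e) + Y (target e)) else 0) = 2 * Y (0, 0) + 2 * Y u := by
  have h4 : ∀ a : ZMod 4, 4 * a = 0 := by decide
  rw [Fintype.sum_sum_type, Fintype.sum_prod_type, Fintype.sum_prod_type]
  -- On the first leg only edges with second coordinate `0` count; on the second leg (`key2`) only
  -- those with first coordinate `u.1`.
  have key1 : ∀ i : Fin m, ∑ j : Fin (m + 1), (if OnArm (corner hN u) (midpoint hN (.inl (i, j)))
      then 2 * (Y (source (.inl (i, j))) + Y (target (.inl (i, j)))) else 0) =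
      if (i : ℕ) < u.1 then 2 * (Y (i.castSucc, 0) + Y (i.succ, 0)) else 0 := by
    intro i
    rw [Finset.sum_eq_single 0]
    · refine if_congr ?_ rfl rfl
      simp only [OnArm, corner, midpoint, Fin.val_zero, true_and]
      omega
    · intro j _ hj
      rw [if_neg]
      have : (j : ℕ) ≠ 0 := fun h => hj (Fin.ext h)
      simp only [OnArm, corner, midpoint]
      omega
    · simp
  have key2 : ∀ i : Fin (m + 1), ∑ j : Fin m, (if OnArm (corner hN u) (midpoint hN (.inr (i, j)))
      then 2 * (Y (source (.inr (i, j))) + Y (target (.inr (i, j)))) else 0) =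
      if i = u.1 then ∑ j : Fin m, (if (j : ℕ) < u.2 then
        2 * (Y (u.1, j.castSucc) + Y (u.1, j.succ)) else 0) else 0 := by
    intro i
    split_ifs with hi
    · subst hi
      refine Finset.sum_congr rfl fun j _ => if_congr ?_ rfl rfl
      simp only [OnArm, corner, midpoint, true_and]
      omega
    · refine Finset.sum_eq_zero fun j _ => if_neg ?_
      have : (i : ℕ) ≠ u.1 := fun h => hi (Fin.ext h)
      simp only [OnArm, corner, midpoint]
      omega
  simp only [key1, key2, Finset.sum_ite_eq', Finset.mem_univ, if_true]
  have e1 : ∑ i : Fin m, (if (i : ℕ) < u.1 then 2 * (Y (i.castSucc, 0) + Y (i.succ, 0)) else 0) =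
      2 * Y (0, 0) + 2 * Y (u.1, 0) := by
    -- The extension of `Y` by `0` is harmless: no index above `m` occurs in the sum.
    have := sum_telescope (fun k => if h : k < m + 1 then Y (⟨k, h⟩, 0) else 0) (fun k => h4 _) m
      u.1 (by omega)
    rw [← Fin.sum_univ_eq_sum_range
      (fun k => if k < (u.1 : ℕ) then 2 * ((if h : k < m + 1 then Y (⟨k, h⟩, 0) else 0) +
        (if h : k + 1 < m + 1 then Y (⟨k + 1, h⟩, 0) else 0)) else 0)] at this
    simpa [Fin.is_lt, Nat.lt_succ_of_lt, Fin.castSucc, Fin.castAdd, Fin.castLE, Fin.succ, Nat.le_of_lt_succ u.1.2]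
      using this
  have e2 : ∑ j : Fin m, (if (j : ℕ) < u.2 then
        2 * (Y (u.1, j.castSucc) + Y (u.1, j.succ)) else 0) = 2 * Y (u.1, 0) + 2 * Y u := by
    have := sum_telescope (fun k => if h : k < m + 1 then Y (u.1, ⟨k, h⟩) else 0) (fun k => h4 _) m
      u.2 (by omega)
    rw [← Fin.sum_univ_eq_sum_range
      (fun k => if k < (u.2 : ℕ) then 2 * ((if h : k < m + 1 then Y (u.1, ⟨k, h⟩) else 0) +
        (if h : k + 1 < m + 1 then Y (u.1, ⟨k + 1, h⟩) else 0)) else 0)] at this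
    simpa [Fin.is_lt, Nat.lt_succ_of_lt, Fin.castSucc, Fin.castAdd, Fin.castLE, Fin.succ, Nat.le_of_lt_succ u.2.2]
      using this
  rw [e1, e2]
  -- The elbow `(u.1, 0)` ends both legs, so it cancels.
  linear_combination h4 (Y (u.1, 0))

/-! ### The instances and an explicit element of their linear sets. -/

open Classical in
/-- The instance bits `b` that carry the bits `t` at the three vertices `u` of the coarse grid and
vanish elsewhere. -/
noncomputable def phaseBits (u : Fin 3 → Fin (m + 1) × Fin (m + 1)) (t : Fin 3 → Bool)
    (v : Vertex N) : Bool :=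
  decide (∃ i, v = corner hN (u i) ∧ t i = true)

/-- The element of the linear set of the instance `(gridBits, phaseBits u t)` that is `1` at all
vertices with even coordinates, and equal to the sum of the arms of the `u i` with `t i = 1` at the
other vertices. -/
def armVector (u : Fin 3 → Fin (m + 1) × Fin (m + 1)) (t : Fin 3 → Bool) (v : Vertex N) : Bool :=
  if v.1.1 % 2 = 0 ∧ v.2.1 % 2 = 0 then true else
    xor (xor (t 0 && decide (OnArm (corner hN (u 0)) v)) (t 1 && decide (OnArm (corner hN (u 1)) v)))
      (t 2 && decide (OnArm (corner hN (u 2)) v))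

theorem sum_phaseBits_mul {u : Fin 3 → Fin (m + 1) × Fin (m + 1)} (hu : Function.Injective u)
    (t : Fin 3 → Bool) (g : Vertex N → ZMod 4) :
    ∑ v, bit (phaseBits hN u t v) * g v = ∑ i, bit (t i) * g (corner hN (u i)) := by
  symm
  refine Fintype.sum_of_injective (fun i => corner hN (u i)) ((corner_injective hN).comp hu) _ _
    ?_ fun i => ?_
  · intro v hv
    have : ¬ ∃ i, v = corner hN (u i) ∧ t i = true := fun ⟨i, hi, _⟩ => hv ⟨i, hi.symm⟩
    simp [phaseBits, this, bit]
  · have : (∃ j, corner hN (u i) = corner hN (u j) ∧ t j = true) ↔ t i = true := by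
      refine ⟨fun ⟨j, hj, hj'⟩ => ?_, fun h => ⟨i, rfl, h⟩⟩
      rwa [hu (corner_injective hN hj)]
    simp [phaseBits, this]

theorem armVector_corner (u : Fin 3 → Fin (m + 1) × Fin (m + 1)) (t : Fin 3 → Bool)
    (p : Fin (m + 1) × Fin (m + 1)) : armVector hN u t (corner hN p) = true := by
  simp [armVector, corner]

theorem two_mul_bit_armVector_midpoint (u : Fin 3 → Fin (m + 1) × Fin (m + 1)) (t : Fin 3 → Bool)
    (e : CoarseEdge m) :
    2 * bit (armVector hN u t (midpoint hN e)) =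
      ∑ i, bit (t i) * (if OnArm (corner hN (u i)) (midpoint hN e) then 2 else 0) := by
  have hodd : ¬ ((midpoint hN e).1.1 % 2 = 0 ∧ (midpoint hN e).2.1 % 2 = 0) := by
    rcases e with ⟨i, j⟩ | ⟨i, j⟩ <;> simp only [midpoint] <;> omega
  have hand : ∀ a b : Bool, 2 * bit (a && b) = bit a * if b = true then 2 else 0 := by decide
  rw [armVector, if_neg hodd, two_mul_bit_xor, two_mul_bit_xor, Fin.sum_univ_three]
  simp only [hand, decide_eq_true_eq]

/-- Each selected arm ends at its tip and at the origin. The origin is hit an even number of times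
because `t` has even weight, so only the tips survive. -/
theorem sum_armVector_mul (u : Fin 3 → Fin (m + 1) × Fin (m + 1)) {t : Fin 3 → Bool}
    (ht : 2 * ∑ i, bit (t i) = 0) (Y : Fin (m + 1) × Fin (m + 1) → ZMod 4) :
    ∑ e : CoarseEdge m, 2 * bit (armVector hN u t (midpoint hN e)) *
      (Y (source e) + Y (target e)) = ∑ i, bit (t i) * (2 * Y (u i)) := by
  simp only [two_mul_bit_armVector_midpoint, Finset.sum_mul]
  rw [Finset.sum_comm]
  have : ∀ i, ∑ e : CoarseEdge m, bit (t i) * (if OnArm (corner hN (u i)) (midpoint hN e) then 2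
      else 0) * (Y (source e) + Y (target e)) = bit (t i) * (2 * Y (0, 0) + 2 * Y (u i)) := by
    intro i
    rw [← sum_onArm hN Y (u i), Finset.mul_sum]
    refine Finset.sum_congr rfl fun e _ => ?_
    rw [mul_assoc, ite_mul, zero_mul]
  rw [Finset.sum_congr rfl fun i _ => this i]
  simp only [mul_add, Finset.sum_add_distrib]
  rw [← Finset.sum_mul]
  linear_combination Y (0, 0) * ht

/-- Both ends of every coarse edge carry `1`, so all edge terms are multiples of `4` and only the
phases remain. -/
theorem quadForm_armVector {u : Fin 3 → Fin (m + 1) × Fin (m + 1)} (hu : Function.Injective u)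
    (t : Fin 3 → Bool) :
    quadForm (gridBits hN) (phaseBits hN u t) (armVector hN u t) = ∑ i, bit (t i) := by
  have h : ∀ a : Bool, 2 * bit a * (bit true + bit true) = 0 := by decide
  rw [quadForm_gridBits, sum_phaseBits_mul hN hu]
  simp only [armVector_corner, h, Finset.sum_const_zero, zero_add]
  simp [bit]

/-- Flipping `y` at every corner changes each edge term by a multiple of `4`, but at `u i` the phase
term becomes `1 - y` instead of `1 + y`. The arm ending at `u i` contributes the missing `2 * y`. -/
theorem armVector_mem_linearSet {u : Fin 3 → Fin (m + 1) × Fin (m + 1)}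
    (hu : Function.Injective u) {t : Fin 3 → Bool} (ht : 2 * ∑ i, bit (t i) = 0) :
    armVector hN u t ∈ linearSet (gridBits hN) (phaseBits hN u t) := by
  intro y
  have h1 : ∀ a b c d : Bool, 2 * bit (xor a b) * (bit (xor true c) + bit (xor true d)) =
      2 * bit a * (bit c + bit d) + 2 * bit b * (bit c + bit d) := by decide
  have h2 : ∀ a : Bool, bit (xor true a) = 1 - bit a := by decide
  rw [quadForm_armVector hN hu, quadForm_gridBits, quadForm_gridBits, sum_phaseBits_mul hN hu,
    sum_phaseBits_mul hN hu _ (fun v => bit (y v))]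
  simp only [armVector_corner, h1, Finset.sum_add_distrib]
  rw [sum_armVector_mul hN u ht (fun p => bit (y (corner hN p)))]
  simp only [h2, mul_sub, mul_one, Finset.sum_sub_distrib, mul_left_comm _ (2 : ZMod 4),
    ← Finset.mul_sum]
  ring

/-! ### The parity contradiction. -/

/-- The four bit strings of length three of even weight. -/
def evenBits : Fin 4 → Fin 3 → Bool :=
  ![![false, false, false], ![true, true, false], ![true, false, true], ![false, true, true]]

/-- Solutions `z t` of the four instances `(gridBits, phaseBits u t)` with `t` of even weight cannot
be local: if `z t v` depends only on the bits `t i` with `dep v i`, then some `z t v` depends on two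
bits, or some `z t v` with `v` on the arm of `u i` depends on another bit `t j`. -/
theorem not_isSolution_of_local {u : Fin 3 → Fin (m + 1) × Fin (m + 1)}
    (hu : Function.Injective u) (z : (Fin 3 → Bool) → Vertex N → Bool)
    (dep : Vertex N → Fin 3 → Prop)
    (hz : ∀ v t t', (∀ i, dep v i → t i = t' i) → z t v = z t' v)
    (hdep : ∀ v i j, i ≠ j → dep v i → ¬ dep v j)
    (harm : ∀ v i j, i ≠ j → dep v i → ¬ OnArm (corner hN (u j)) v) :
    ¬ ∀ k, IsSolution (gridBits hN) (phaseBits hN u (evenBits k)) (z (evenBits k)) := by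
  intro hsol
  have heven : ∀ k, 2 * ∑ i, bit (evenBits k i) = 0 := by decide
  have h1 : ∀ k, ∑ i, bit (evenBits k i) =
      2 * ∑ v, bit (z (evenBits k) v) * bit (armVector hN u (evenBits k) v) := by
    intro k
    rw [← quadForm_armVector hN hu]
    exact hsol k _ (armVector_mem_linearSet hN hu (heven k))
  have h2 : ∀ v, ∑ k, 2 * (bit (z (evenBits k) v) * bit (armVector hN u (evenBits k) v)) = 0 := by
    intro v
    by_cases hv : v.1.1 % 2 = 0 ∧ v.2.1 % 2 = 0
    · have hx : ∀ k, armVector hN u (evenBits k) v = true := fun k => by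
        rw [armVector, if_pos hv]
      -- At a corner the output depends on at most one bit `i`; the index `0` is a dummy when it
      -- depends on none. Each value of bit `i` occurs in exactly two even strings, so the terms
      -- cancel in pairs.
      obtain ⟨i, hi⟩ : ∃ i, ∀ j, dep v j → j = i := by
        by_cases h : ∃ i, dep v i
        · obtain ⟨i, hi⟩ := h
          exact ⟨i, fun j hj => by_contra fun hne => hdep v j i hne hj hi⟩
        · exact ⟨0, fun j hj => absurd ⟨j, hj⟩ h⟩
      have hz' : ∀ k l, evenBits k i = evenBits l i → z (evenBits k) v = z (evenBits l) v :=
        fun k l hkl => hz v _ _ fun j hj => by rw [hi j hj, hkl]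
      have h4 : ∀ a b : Bool, 2 * (bit a * bit true) + 2 * (bit b * bit true) +
          2 * (bit a * bit true) + 2 * (bit b * bit true) = 0 := by decide
      have h4' : ∀ a b : Bool, 2 * (bit a * bit true) + 2 * (bit b * bit true) +
          2 * (bit b * bit true) + 2 * (bit a * bit true) = 0 := by decide
      have h4'' : ∀ a b : Bool, 2 * (bit a * bit true) + 2 * (bit a * bit true) +
          2 * (bit b * bit true) + 2 * (bit b * bit true) = 0 := by decide
      simp only [Fin.sum_univ_four, hx]
      fin_cases i
      · rw [hz' 0 3 rfl, hz' 1 2 rfl]; exact h4' _ _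
      · rw [hz' 0 2 rfl, hz' 1 3 rfl]; exact h4 _ _
      · rw [hz' 0 1 rfl, hz' 2 3 rfl]; exact h4'' _ _
    · have hz' : ∀ i k l, OnArm (corner hN (u i)) v → evenBits k i = evenBits l i →
          z (evenBits k) v = z (evenBits l) v := by
        intro i k l hi hkl
        refine hz v _ _ fun j hj => ?_
        by_cases hji : j = i
        · rw [hji, hkl]
        · exact absurd hi (harm v j i hji hj)
      -- On the arm of `u i` the output depends at most on `t i`, so it agrees on the two strings
      -- with `t i = 1`. If `v` lies on several arms, the output is the same on all three nonzero
      -- strings, and the arm vector is `1` on an even number of them.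
      have key : ∀ z0 z1 z2 z3 a0 a1 a2 : Bool,
          (a0 = true → z1 = z2) → (a1 = true → z1 = z3) → (a2 = true → z2 = z3) →
          2 * (bit z0 * bit (xor (xor (false && a0) (false && a1)) (false && a2))) +
          2 * (bit z1 * bit (xor (xor (true && a0) (true && a1)) (false && a2))) +
          2 * (bit z2 * bit (xor (xor (true && a0) (false && a1)) (true && a2))) +
          2 * (bit z3 * bit (xor (xor (false && a0) (true && a1)) (true && a2))) = 0 := by
        decide
      simp only [Fin.sum_univ_four, armVector, if_neg hv]
      exact key _ _ _ _ _ _ _ (fun h => hz' 0 1 2 (of_decide_eq_true h) rfl)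
        (fun h => hz' 1 1 3 (of_decide_eq_true h) rfl)
        (fun h => hz' 2 2 3 (of_decide_eq_true h) rfl)
  have h3 : ∑ k, ∑ i, bit (evenBits k i) = 0 := by
    simp only [h1, Finset.mul_sum]
    rw [Finset.sum_comm]
    exact Finset.sum_eq_zero fun v _ => h2 v
  exact absurd h3 (by decide)

/-! ### Choosing three independent coarse vertices by counting. -/

theorem card_onArm_le (p : Vertex N) :
    (Finset.univ.filter fun v => OnArm p v).card ≤ 2 * N := by
  let F : Fin N ⊕ Fin N → Vertex N := Sum.elim (fun i => (i, ⟨0, i.pos⟩)) fun j => (p.1, j)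
  have h : (Finset.univ.filter fun v => OnArm p v) ⊆ Finset.univ.image F := by
    intro v hv
    rw [Finset.mem_filter, OnArm] at hv
    rw [Finset.mem_image]
    rcases hv.2 with h | h
    · exact ⟨Sum.inl v.1, Finset.mem_univ _, Prod.ext rfl (Fin.ext h.1.symm)⟩
    · exact ⟨Sum.inr v.2, Finset.mem_univ _, Prod.ext (Fin.ext h.1.symm) rfl⟩
  refine (Finset.card_le_card h).trans (Finset.card_image_le.trans ?_)
  simp [two_mul]

/-- If every `B v` has at most `s` elements and `s` is small compared to `m`, then there are three
vertices `u i` of the coarse grid such that no `B v` contains two of them, and if `B v` contains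
`u i`, then `v` does not lie on the arm of another `u j`. -/
theorem exists_triple (B : Vertex N → Finset (Fin (m + 1) × Fin (m + 1))) (s : ℕ)
    (hB : ∀ v, (B v).card ≤ s)
    (hs : 6 * ((m + 1) ^ 2 + s * (s * N ^ 2 + (m + 1) ^ 2 * (2 * N))) < (m + 1) ^ 4) :
    ∃ u : Fin 3 → Fin (m + 1) × Fin (m + 1), Function.Injective u ∧
      ∀ v i j, i ≠ j → u i ∈ B v → u j ∉ B v ∧ ¬ OnArm (corner hN (u j)) v := by
  classical
  let R : Fin (m + 1) × Fin (m + 1) → Fin (m + 1) × Fin (m + 1) → Prop := fun a b =>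
    a = b ∨ ∃ v, a ∈ B v ∧ (b ∈ B v ∨ OnArm (corner hN b) v)
  have hcard : (Finset.univ.filter fun p : (Fin (m + 1) × Fin (m + 1)) ×
      (Fin (m + 1) × Fin (m + 1)) => R p.1 p.2).card ≤
      (m + 1) ^ 2 + s * (s * N ^ 2 + (m + 1) ^ 2 * (2 * N)) := by
    have hsub : (Finset.univ.filter fun p : (Fin (m + 1) × Fin (m + 1)) ×
        (Fin (m + 1) × Fin (m + 1)) => R p.1 p.2) ⊆ Finset.univ.image (fun a => (a, a)) ∪
        Finset.univ.biUnion fun v =>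
          B v ×ˢ (B v ∪ Finset.univ.filter fun b => OnArm (corner hN b) v) := by
      rintro ⟨a, b⟩ h
      rw [Finset.mem_union]
      rcases (Finset.mem_filter.1 h).2 with h | ⟨v, hv⟩
      · exact Or.inl (Finset.mem_image.2 ⟨a, Finset.mem_univ _, Prod.ext rfl h⟩)
      · exact Or.inr (Finset.mem_biUnion.2 ⟨v, Finset.mem_univ _, by
          simpa [and_or_left] using hv⟩)
    -- Double counting: sum over tips instead, each arm having at most `2 * N` vertices.
    have hcount : ∑ v : Vertex N, (Finset.univ.filter fun b => OnArm (corner hN b) v).card ≤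
        (m + 1) ^ 2 * (2 * N) := by
      simp only [Finset.card_filter]
      rw [Finset.sum_comm]
      simp only [← Finset.card_filter]
      refine (Finset.sum_le_card_nsmul _ _ (2 * N) fun b _ => card_onArm_le _).trans ?_
      simp [sq]
    refine (Finset.card_le_card hsub).trans ((Finset.card_union_le _ _).trans ?_)
    refine Nat.add_le_add (Finset.card_image_le.trans (by simp [sq])) ?_
    calc _ ≤ ∑ v, (B v ×ˢ (B v ∪ Finset.univ.filter fun b => OnArm (corner hN b) v)).card :=
          Finset.card_biUnion_le
      _ ≤ ∑ v, s * (s + (Finset.univ.filter fun b => OnArm (corner hN b) v).card) := by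
          refine Finset.sum_le_sum fun v _ => ?_
          rw [Finset.card_product]
          exact Nat.mul_le_mul (hB v)
            ((Finset.card_union_le _ _).trans (Nat.add_le_add_right (hB v) _))
      _ ≤ _ := by
          rw [← Finset.mul_sum, Finset.sum_add_distrib]
          refine Nat.mul_le_mul_left _ (Nat.add_le_add (le_of_eq ?_) hcount)
          simp only [Finset.sum_const, Finset.card_univ, Fintype.card_prod, Fintype.card_fin,
            smul_eq_mul]
          ring
  obtain ⟨u, hu⟩ := exists_triple_of_card_lt R (by
    refine (Nat.mul_le_mul_left 6 hcard).trans_lt (hs.trans_eq ?_)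
    simp only [Fintype.card_prod, Fintype.card_fin]
    ring)
  refine ⟨u, fun i j hij => by_contra fun hne => hu i j hne (Or.inl hij), fun v i j hij hi => ?_⟩
  have := hu i j hij
  exact ⟨fun h => this (Or.inr ⟨v, hi, Or.inl h⟩), fun h => this (Or.inr ⟨v, hi, Or.inr h⟩)⟩

/-- A probabilistic circuit each of whose outputs depends on at most `s` inputs fails with
probability at least `1 / 8` on some instance, if `s` is small compared to the grid. -/
theorem exists_successProb_le (hN : 2 * m + 1 ≤ N) {l : ℕ}
    (C : BoolCircuit (InputVar N l) (Vertex N)) (ρ : PMF (Fin l → Bool)) (s : ℕ)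
    (hC : ∀ v, ∃ S : Finset (InputVar N l), S.card ≤ s ∧
      ∀ x y, (∀ i ∈ S, x i = y i) → C.eval x v = C.eval y v)
    (hs : 6 * ((m + 1) ^ 2 + s * (s * N ^ 2 + (m + 1) ^ 2 * (2 * N))) < (m + 1) ^ 4) :
    ∃ A b, successProb C ρ A b ≤ 7 / 8 := by
  classical
  by_contra! hcon
  choose S hS hdep using hC
  let inp : Fin (m + 1) × Fin (m + 1) → InputVar N l := fun p => Sum.inl (Sum.inr (corner hN p))
  have hinp : Function.Injective inp := fun p q h =>
    corner_injective hN (Sum.inr_injective (Sum.inl_injective h))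
  obtain ⟨u, hu, huB⟩ := exists_triple hN
    (fun v => Finset.univ.filter fun p => inp p ∈ S v) s (fun v => by
      refine le_trans (Finset.card_le_card_of_injOn inp ?_ hinp.injOn) (hS v)
      intro p hp
      simpa using hp) hs
  simp only [Finset.mem_filter, Finset.mem_univ, true_and] at huB
  -- Fixing `r` makes the circuit deterministic; the four instances then differ only in the inputs
  -- `b` at the `u i`.
  obtain ⟨r, hr⟩ := MeasureTheory.exists_forall_mem_of_lt ρ.toMeasure (ι := Fin 4) (by simp)
    (fun k => {r | IsSolution (gridBits hN) (phaseBits hN u (evenBits k))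
      (C.eval (inputBits (gridBits hN) (phaseBits hN u (evenBits k)) r))})
    (fun k => (Set.toFinite _).measurableSet) fun k => hcon _ _
  refine not_isSolution_of_local hN hu
    (fun t => C.eval (inputBits (gridBits hN) (phaseBits hN u t) r)) (fun v i => inp (u i) ∈ S v)
    ?_ (fun v i j hij hi => (huB v i j hij hi).1) (fun v i j hij hi => (huB v i j hij hi).2) hr
  intro v t t' htt'
  refine hdep v _ _ ?_
  rintro ((e | w) | k) hx
  · rfl
  · simp only [inputBits, Sum.elim_inl, Sum.elim_inr, phaseBits, decide_eq_decide]
    refine exists_congr fun i => and_congr_right fun hw => ?_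
    rw [htt' i (by rwa [hw] at hx)]
  · rfl

/-- With `n` the coarse side, `N ≤ 2 * n`, so the bad pairs number `O(s ^ 2 * n ^ 2 + s * n ^ 3)`
against `n ^ 4`. The exponent `8` leaves ample room. -/
theorem card_bound_of_pow_le {s : ℕ} (hs : s ^ 8 ≤ N) (hN1 : 2000 ≤ N) :
    6 * (((N - 1) / 2 + 1) ^ 2 +
      s * (s * N ^ 2 + ((N - 1) / 2 + 1) ^ 2 * (2 * N))) < ((N - 1) / 2 + 1) ^ 4 := by
  obtain ⟨n, hn⟩ : ∃ n, n = (N - 1) / 2 + 1 := ⟨_, rfl⟩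
  rw [← hn]
  have hNn : N ≤ 2 * n := by omega
  have hn1 : 1000 ≤ n := by omega
  -- For `s ≥ 4`, `s ^ 6 ≥ 4096` suffices; for `s ≤ 3`, `100 * s ^ 2 ≤ 900`, which is where `N ≥
  -- 2000` enters.
  have hsn : 100 * s ^ 2 ≤ n := by
    by_contra! h
    rcases Nat.lt_or_ge s 4 with h4 | h4
    · interval_cases s <;> omega
    · have h6 : 4 ^ 6 ≤ s ^ 6 := Nat.pow_le_pow_left h4 6
      have : s ^ 8 = s ^ 6 * s ^ 2 := by ring
      nlinarith [Nat.mul_le_mul_right (s ^ 2) h6]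
  have hs1 : s ≤ s ^ 2 := Nat.le_self_pow two_ne_zero s
  have e1 : N ^ 2 ≤ (2 * n) ^ 2 := Nat.pow_le_pow_left hNn 2
  calc 6 * (n ^ 2 + s * (s * N ^ 2 + n ^ 2 * (2 * N)))
      = 6 * n ^ 2 + 6 * (s ^ 2 * N ^ 2) + 12 * (s * (n ^ 2 * N)) := by ring
    _ ≤ 6 * n ^ 2 + 6 * (s ^ 2 * (2 * n) ^ 2) + 12 * (s ^ 2 * (n ^ 2 * (2 * n))) := by gcongr
    _ = n ^ 2 * (6 + 24 * s ^ 2 + 24 * (s ^ 2 * n)) := by ring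
    _ < n ^ 2 * n ^ 2 := by
      refine Nat.mul_lt_mul_of_pos_left ?_ (by positivity)
      nlinarith [Nat.mul_le_mul_right n hsn]
    _ = n ^ 4 := by ring

end HLF2D

theorem theorem2 :
    ∃ N₀ : ℕ, ∀ N : ℕ, N₀ ≤ N →
      ∀ (K l : ℕ) (C : BoolCircuit (HLF2D.InputVar N l) (HLF2D.Vertex N))
        (ρ : PMF (Fin l → Bool)),
        C.FanInAtMost K →
        (∀ (A : HLF2D.Edge N → Bool) (b : HLF2D.Vertex N → Bool),
          7 / 8 < HLF2D.successProb C ρ A b) →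
        2 ≤ K ∧ (1 / 8 : ℝ) * (Real.log (N : ℝ) / Real.log (K : ℝ)) ≤ (C.depth : ℝ) := by
  refine ⟨2000, fun N hN K l C ρ hK hC => ?_⟩
  -- Stated for any `L ≥ K` with `L ≥ 1`, so that `L = 1` also rules out `K = 0`, where powers of
  -- `K` are not monotone in the exponent.
  have key : ∀ L : ℕ, 1 ≤ L → K ≤ L → N < (L ^ C.depth) ^ 8 := by
    intro L hL hKL
    by_contra! h
    obtain ⟨A, b, hAb⟩ := HLF2D.exists_successProb_le (m := (N - 1) / 2) (by omega) C ρ _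
      (C.exists_eval_dependsOn (fun g => (hK g).trans hKL) hL) (HLF2D.card_bound_of_pow_le h hN)
    exact absurd (hC A b) hAb.not_gt
  have hK2 : 2 ≤ K := by
    by_contra! h
    have := key 1 le_rfl (by omega)
    simp only [one_pow] at this
    omega
  refine ⟨hK2, ?_⟩
  have hlog : 0 < Real.log K := Real.log_pos (by exact_mod_cast hK2)
  have h1 : Real.log N ≤ Real.log (((K : ℝ) ^ C.depth) ^ 8) :=
    Real.log_le_log (by exact_mod_cast (by omega : 0 < N)) (by
      exact_mod_cast (key K (by omega) le_rfl).le)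
  rw [Real.log_pow, Real.log_pow] at h1
  push_cast at h1
  have h2 : Real.log N / Real.log K ≤ 8 * C.depth := by
    rw [div_le_iff₀ hlog]
    linarith
  linarith
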